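/- Let $D$ be a finite (nonempty) distributive lattice. Then there is a finite (nonempty) planar semimodular lattice $K$ such that $D$ is isomorphic to $\operatorname{Con} K$, the lattice of all congruences of $K$ ordered by inclusion. Here a finite lattice is called planar if it has a Hasse diagram in the plane, with distinct points for the elements and each covering pair $a \prec b$ drawn as a straight line segment ascending from $a$ to $b$, in which the segments meet each other and the points of the diagram only at their endpoints; and a lattice is called semimodular if $a \wedge b \prec a$ implies $b \prec a \vee b$. -/

import Mathlib

namespace LatticeCon

variable {K : Type*} [Lattice K]

theorem toSetoid_injective :
    Function.Injective (LatticeCon.toSetoid : LatticeCon K → Setoid K) := by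
  rintro ⟨s, _, _⟩ ⟨t, _, _⟩ h
  cases h
  rfl

/-- Congruences are ordered by inclusion: `c ≤ d` iff every pair of elements
that is congruent modulo `c` is congruent modulo `d`. -/
instance instPartialOrder : PartialOrder (LatticeCon K) where
  le c d := ∀ ⦃x y : K⦄, c.r x y → d.r x y
  le_refl _ _ _ h := h
  le_trans _ _ _ h₁ h₂ _ _ h := h₂ (h₁ h)
  le_antisymm _ _ h₁ h₂ :=
    toSetoid_injective (Setoid.ext fun _ _ => ⟨fun h => h₁ h, fun h => h₂ h⟩)

/-- The intersection of a set of congruences. -/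
instance instInfSet : InfSet (LatticeCon K) where
  sInf S :=
    { r := fun x y => ∀ c ∈ S, c.r x y
      iseqv :=
        ⟨fun x c _ => c.iseqv.refl x, fun h c hc => c.iseqv.symm (h c hc),
          fun h₁ h₂ c hc => c.iseqv.trans (h₁ c hc) (h₂ c hc)⟩
      inf := fun h₁ h₂ c hc => c.inf (h₁ c hc) (h₂ c hc)
      sup := fun h₁ h₂ c hc => c.sup (h₁ c hc) (h₂ c hc) }

theorem isGLB_sInf_set (S : Set (LatticeCon K)) : IsGLB S (sInf S) :=
  ⟨fun _ hc _ _ h => h _ hc, fun _ hd _ _ h c hc => hd hc h⟩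

/-- The congruence lattice `Con K`: the congruences of `K`, ordered by inclusion. -/
instance instCompleteLattice : CompleteLattice (LatticeCon K) :=
  completeLatticeOfInf (LatticeCon K) isGLB_sInf_set

end LatticeCon

/-- `p` is a planar Hasse diagram of the order `K`: the elements are drawn as distinct points
of the plane, every covering pair `a ⋖ b` is drawn as the straight line segment from `p a`
to `p b`, with `b` higher than `a`, and these segments meet each other and the points of the
diagram only at their endpoints. -/
structure IsPlanarDiagram {K : Type*} [PartialOrder K] (p : K → ℝ × ℝ) : Prop where
  injective : Function.Injective p
  upward : ∀ ⦃a b : K⦄, a ⋖ b → (p a).2 < (p b).2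
  notMem_edge : ∀ ⦃a b : K⦄, a ⋖ b → ∀ c : K, p c ∉ openSegment ℝ (p a) (p b)
  disjoint_edges : ∀ ⦃a b c d : K⦄, a ⋖ b → c ⋖ d → (a, b) ≠ (c, d) →
    Disjoint (openSegment ℝ (p a) (p b)) (openSegment ℝ (p c) (p d))

/-- An order is planar if it has a planar Hasse diagram. -/
def IsPlanarOrder (K : Type*) [PartialOrder K] : Prop :=
  ∃ p : K → ℝ × ℝ, IsPlanarDiagram p

/-!
By Birkhoff's theorem it suffices to represent the lattice of lower sets of a finite preorder `P`
as a congruence lattice. Take the square of a finite chain and insert forks in some of its diagonal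
cells. A fork splits a step of the chain in two, and a congruence that collapses the first half
collapses the second. Colour the steps by `P` so that the two halves of the split steps run through
all pairs `q ≥ p`. Where a row step and a column step of the same colour bound a cell, an eye (an
additional atom turning the cell into an `M₃`) makes every congruence collapse both or none. Hence
a congruence is determined by the set of colours that it collapses, and these sets are exactly the
lower sets of `P`.

The lattice embeds into the real plane with its componentwise order. If the segments of two
covering pairs `a ⋖ b` and `c ⋖ d` meet in an interior point, then `a ⊔ c ≤ b ⊓ d`, so the pairs
share an endpoint and the segments have the same direction; this forces the pairs to be equal.
-/

/-! ### Planarity from order dimension two -/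

section Planarity

theorem mem_segment_or_mem_segment_of_mem_openSegment {𝕜 E : Type*} [Field 𝕜] [LinearOrder 𝕜]
    [IsStrictOrderedRing 𝕜] [AddCommGroup E] [Module 𝕜 E] {a b d z : E}
    (hb : z ∈ openSegment 𝕜 a b) (hd : z ∈ openSegment 𝕜 a d) :
    b ∈ segment 𝕜 a d ∨ d ∈ segment 𝕜 a b := by
  have hsame : SameRay 𝕜 (b - a) (d - a) := by
    have key {v : E} (hv : z ∈ openSegment 𝕜 a v) :
        ∃ t : 𝕜, 0 < t ∧ z - a = t • (v - a) := by
      rw [openSegment_eq_image'] at hv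
      obtain ⟨t, ht, rfl⟩ := hv
      exact ⟨t, ht.1, add_sub_cancel_left _ _⟩
    obtain ⟨s, hs, hsb⟩ := key hb
    obtain ⟨t, ht, htd⟩ := key hd
    exact .inr (.inr ⟨s, t, hs, ht, hsb.symm.trans htd⟩)
  rw [mem_segment_iff_wbtw, mem_segment_iff_wbtw]
  exact wbtw_total_of_sameRay_vsub_left hsame

variable {K : Type*} [Lattice K]

theorem disjoint_openSegment_of_covBy (q : K ↪o ℝ × ℝ) {a b c d : K} (hab : a ⋖ b)
    (hcd : c ⋖ d) (hne : (a, b) ≠ (c, d)) :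
    Disjoint (openSegment ℝ (q a) (q b)) (openSegment ℝ (q c) (q d)) := by
  have between {u v w : K} (huv : u < v) (hw : q w ∈ segment ℝ (q u) (q v)) : w ≤ v ∧ u ≤ w :=
    (segment_subset_Icc (q.monotone huv.le) hw).symm.imp q.le_iff_le.1 q.le_iff_le.1
  have eq_of_common_bot {u v w : K} {z : ℝ × ℝ} (huv : u ⋖ v) (huw : u ⋖ w)
      (hv : z ∈ openSegment ℝ (q u) (q v)) (hw : z ∈ openSegment ℝ (q u) (q w)) : v = w := by
    rcases mem_segment_or_mem_segment_of_mem_openSegment hv hw with h | h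
    · exact (huw.eq_or_eq huv.le (between huw.lt h).1).resolve_left huv.lt.ne'
    · exact ((huv.eq_or_eq huw.le (between huv.lt h).1).resolve_left huw.lt.ne').symm
  have eq_of_common_top {u v w : K} {z : ℝ × ℝ} (huw : u ⋖ w) (hvw : v ⋖ w)
      (hu : z ∈ openSegment ℝ (q u) (q w)) (hv : z ∈ openSegment ℝ (q v) (q w)) : u = v := by
    rw [openSegment_symm] at hu hv
    rcases mem_segment_or_mem_segment_of_mem_openSegment hu hv with h | h <;>
      rw [segment_symm] at h
    · exact (hvw.eq_or_eq (between hvw.lt h).2 huw.le).resolve_right huw.lt.ne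
    · exact ((huw.eq_or_eq (between huw.lt h).2 hvw.le).resolve_right hvw.lt.ne).symm
  refine Set.disjoint_left.2 fun z hz hz' => hne ?_
  have hz_ab := openSegment_subset_Ioo (q.strictMono hab.lt) hz
  have hz_cd := openSegment_subset_Ioo (q.strictMono hcd.lt) hz'
  have had : a < d := q.lt_iff_lt.1 (hz_ab.1.trans hz_cd.2)
  have hcb : c < b := q.lt_iff_lt.1 (hz_cd.1.trans hz_ab.2)
  rcases hab.eq_or_eq le_sup_left (sup_le hab.le hcb.le) with h | h
  · obtain rfl : a = c :=
      (hcd.eq_or_eq (sup_eq_left.1 h) had.le).resolve_right had.ne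
    rw [eq_of_common_bot hab hcd hz hz']
  · obtain rfl : b = d :=
      (hcd.eq_or_eq hcb.le (h.symm.trans_le (sup_le had.le hcd.le))).resolve_left hcb.ne'
    rw [eq_of_common_top hab hcd hz hz']

theorem isPlanarOrder_of_orderEmbedding_real (q : K ↪o ℝ × ℝ) : IsPlanarOrder K := by
  -- A shear makes the second coordinate of the drawing strictly increasing along edges.
  let shear : ℝ × ℝ →ₗ[ℝ] ℝ × ℝ :=
    (LinearMap.fst ℝ ℝ ℝ).prod (LinearMap.fst ℝ ℝ ℝ + LinearMap.snd ℝ ℝ ℝ)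
  have shear_injective : Function.Injective shear := fun u v h => by
    have h₁ : u.1 = v.1 := (congrArg Prod.fst h :)
    have h₂ : u.1 + u.2 = v.1 + v.2 := (congrArg Prod.snd h :)
    exact Prod.ext h₁ (by linarith)
  have image_shear (u v : ℝ × ℝ) :
      openSegment ℝ (shear u) (shear v) = shear '' openSegment ℝ u v :=
    (image_openSegment ℝ shear.toAffineMap u v).symm
  refine ⟨shear ∘ q, shear_injective.comp q.injective, fun a b hab => ?_, fun a b hab c hc => ?_,
    fun a b c d hab hcd hne => ?_⟩
  · rcases Prod.lt_iff.1 (q.strictMono hab.lt) with h | h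
    · exact add_lt_add_of_lt_of_le h.1 h.2
    · exact add_lt_add_of_le_of_lt h.1 h.2
  · obtain ⟨_, hz, h⟩ := (image_shear _ _).subset hc
    obtain rfl := shear_injective h
    have hc' := openSegment_subset_Ioo (q.strictMono hab.lt) hz
    exact hab.2 (q.lt_iff_lt.1 hc'.1) (q.lt_iff_lt.1 hc'.2)
  · simp only [Function.comp_apply, image_shear]
    exact (disjoint_openSegment_of_covBy q hab hcd hne).image shear_injective.injOn
      (Set.subset_univ _) (Set.subset_univ _)

theorem isPlanarOrder_of_orderEmbedding_prod {α β : Type*} [LinearOrder α] [LinearOrder β]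
    [Countable α] [Countable β] (q : K ↪o α × β) : IsPlanarOrder K := by
  obtain ⟨i⟩ := Order.embedding_from_countable_to_dense α ℝ
  obtain ⟨j⟩ := Order.embedding_from_countable_to_dense β ℝ
  exact isPlanarOrder_of_orderEmbedding_real <| q.trans <|
    OrderEmbedding.ofMapLEIff (Prod.map i j) fun _ _ => by simp [Prod.le_def]

end Planarity

section Semimodularity

theorem isUpperModularLattice_of_isWeakUpperModularLattice (K : Type*) [Lattice K]
    [IsWeakUpperModularLattice K] [WellFoundedGT K] [IsStronglyAtomic K] :
    IsUpperModularLattice K := by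
  suffices key : ∀ c a b : K, a ⊓ b = c → c ⋖ a → b ⋖ a ⊔ b from
    ⟨fun {a b} h => key _ a b rfl h⟩
  intro c
  induction c using WellFoundedGT.induction with
  | ind c ih =>
    rintro a b rfl hca
    rcases (inf_le_right : a ⊓ b ≤ b).eq_or_lt with hb | hlt
    · rw [hb] at hca
      rwa [sup_eq_left.2 hca.le]
    obtain ⟨b', hcb', hb'⟩ := exists_covBy_le_of_lt hlt
    have hab' : a ⊓ b' = a ⊓ b :=
      le_antisymm (inf_le_inf_left a hb') (le_inf inf_le_left hcb'.le)
    have hcov : b' ⋖ a ⊔ b' := by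
      rw [← hab'] at hca hcb'
      exact covBy_sup_of_inf_covBy_of_inf_covBy_right hca hcb'
    have hnle : ¬ a ⊔ b' ≤ b := fun hle =>
      hca.lt.ne (inf_eq_left.2 (le_sup_left.trans hle))
    have hinf : (a ⊔ b') ⊓ b = b' :=
      (hcov.eq_or_eq (le_inf le_sup_right hb') inf_le_left).resolve_right
        fun h => hnle (inf_eq_left.1 h)
    have := ih b' hcb'.lt (a ⊔ b') b hinf hcov
    rwa [sup_assoc, sup_eq_right.2 hb'] at this

end Semimodularity

/-! ### Congruences of a lattice -/

section Congruence

variable {L : Type*} [Lattice L] (θ : LatticeCon L)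

theorem latticeCon_rel_of_le_of_le {a b c d : L} (hac : a ≤ c) (hcd : c ≤ d) (hdb : d ≤ b)
    (h : θ.r a b) : θ.r c d := by
  have hcb := θ.sup h (θ.refl c)
  rw [sup_eq_right.2 hac, sup_eq_left.2 (hcd.trans hdb)] at hcb
  have := θ.inf hcb (θ.refl d)
  rwa [inf_eq_left.2 hcd, inf_eq_right.2 hdb] at this

theorem latticeCon_rel_inf_iff_rel_sup (a b : L) : θ.r (a ⊓ b) a ↔ θ.r b (a ⊔ b) := by
  constructor <;> intro h
  · simpa using θ.sup h (θ.refl b)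
  · simpa using θ.inf (θ.refl a) h

/-- The congruence of the chain `ℕ` that collapses exactly the steps `t → t + 1` with `t ∈ S`; it
serves to describe congruences along chains of a lattice. -/
def stepCon (S : Set ℕ) : LatticeCon ℕ where
  r a b := ∀ t, min a b ≤ t → t < max a b → t ∈ S
  iseqv := ⟨by grind, by grind, by grind⟩
  inf := by grind
  sup := by grind

theorem stepCon_rel_of_le {S : Set ℕ} {a b : ℕ} (hab : a ≤ b) :
    (stepCon S).r a b ↔ ∀ t, a ≤ t → t < b → t ∈ S := by
  change (∀ t, min a b ≤ t → t < max a b → t ∈ S) ↔ _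
  rw [min_eq_left hab, max_eq_right hab]

theorem stepCon_rel_succ {S : Set ℕ} {a : ℕ} : (stepCon S).r a (a + 1) ↔ a ∈ S := by
  rw [stepCon_rel_of_le a.le_succ]
  grind

theorem latticeCon_rel_iff_stepCon_rel {s : ℕ → L} (hs : Monotone s) (m n : ℕ) :
    θ.r (s m) (s n) ↔ (stepCon {t | θ.r (s t) (s (t + 1))}).r m n := by
  wlog hmn : m ≤ n generalizing m n
  · rw [θ.comm', (stepCon _).comm']
    exact this n m (le_of_not_ge hmn)
  rw [stepCon_rel_of_le hmn]
  refine ⟨fun h t hmt htn => latticeCon_rel_of_le_of_le θ (hs hmt) (hs t.le_succ) (hs htn) h, ?_⟩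
  induction n, hmn using Nat.le_induction with
  | base => exact fun _ => θ.refl _
  | succ n hmn ih =>
    exact fun h => θ.trans (ih fun t hmt htn => h t hmt (htn.trans n.lt_succ_self))
      (h n hmn n.lt_succ_self)

/-- The elements `a`, `b`, `c` are the atoms of a sublattice `M₃` with bottom `o` and top `i`;
`M₃` is simple, so a congruence identifies the ends of one of its edges only together with
all of it. -/
structure IsDiamond (o a b c i : L) : Prop where
  inf_ab : a ⊓ b = o
  inf_bc : b ⊓ c = o
  inf_ca : c ⊓ a = o
  sup_ab : a ⊔ b = i
  sup_bc : b ⊔ c = i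
  sup_ca : c ⊔ a = i

namespace IsDiamond

variable {θ} {o a b c i : L}

theorem rotate (h : IsDiamond o a b c i) : IsDiamond o b c a i :=
  ⟨h.inf_bc, h.inf_ca, h.inf_ab, h.sup_bc, h.sup_ca, h.sup_ab⟩

theorem rel_bot_iff_rel_top (h : IsDiamond o a b c i) : θ.r o a ↔ θ.r b i := by
  rw [← h.inf_ab, ← h.sup_ab, latticeCon_rel_inf_iff_rel_sup]

theorem rel_bot_iff_rel_top' (h : IsDiamond o a b c i) : θ.r o b ↔ θ.r a i := by
  rw [← h.inf_ab, ← h.sup_ab, inf_comm, sup_comm, latticeCon_rel_inf_iff_rel_sup]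

theorem rel_bot_iff_rel_bot (h : IsDiamond o a b c i) : θ.r o a ↔ θ.r o b := by
  rw [h.rotate.rotate.rel_bot_iff_rel_top', ← h.rotate.rel_bot_iff_rel_top]

theorem rel_bot_iff_rel_self_top (h : IsDiamond o a b c i) : θ.r o a ↔ θ.r a i := by
  rw [h.rel_bot_iff_rel_bot, h.rel_bot_iff_rel_top']

theorem rel_bot_top_iff (h : IsDiamond o a b c i) : θ.r o i ↔ θ.r o a := by
  have hoa : o ≤ a := h.inf_ab ▸ inf_le_left
  have hai : a ≤ i := h.sup_ab ▸ le_sup_left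
  exact ⟨latticeCon_rel_of_le_of_le θ le_rfl hoa hai,
    fun h' => θ.trans h' (h.rel_bot_iff_rel_self_top.1 h')⟩

end IsDiamond

end Congruence

/-! ### Inserting eyes into a lattice -/

/-- A family of pairs of incomparable elements of a lattice, marking the intervals
`[left e ⊓ right e, left e ⊔ right e]` into which an eye is inserted. -/
structure EyeFamily (L E : Type*) [Lattice L] where
  left : E → L
  right : E → L
  not_left_le : ∀ e, ¬ left e ≤ right e
  not_right_le : ∀ e, ¬ right e ≤ left e

namespace EyeFamily

variable {L E : Type*} [Lattice L] (F : EyeFamily L E)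

/-- The bottom of the marked interval. -/
def bot (e : E) : L := F.left e ⊓ F.right e

/-- The top of the marked interval. -/
def top (e : E) : L := F.left e ⊔ F.right e

theorem bot_lt_left (e : E) : F.bot e < F.left e := inf_lt_left.2 (F.not_left_le e)

theorem bot_lt_right (e : E) : F.bot e < F.right e := inf_lt_right.2 (F.not_right_le e)

theorem left_lt_top (e : E) : F.left e < F.top e := left_lt_sup.2 (F.not_right_le e)

theorem right_lt_top (e : E) : F.right e < F.top e := right_lt_sup.2 (F.not_left_le e)

theorem bot_lt_top (e : E) : F.bot e < F.top e := (F.bot_lt_left e).trans (F.left_lt_top e)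

/-- The lattice `L` with one new element, the eye, inserted between the bottom and the top of
each marked interval, as a common complement of its two sides in the interval. -/
inductive Eyed (F : EyeFamily L E)
  | base (x : L)
  | eye (e : E)

namespace Eyed

variable {F}

/-- The largest element of `L` below an element. -/
def lower : F.Eyed → L
  | base x => x
  | eye e => F.bot e

/-- The smallest element of `L` above an element. -/
def upper : F.Eyed → L
  | base x => x
  | eye e => F.top e

theorem lower_le_upper : ∀ u : F.Eyed, u.lower ≤ u.upper
  | base _ => le_rfl
  | eye e => (F.bot_lt_top e).le

instance : PartialOrder F.Eyed where
  le u v := u = v ∨ u.upper ≤ v.lower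
  le_refl _ := .inl rfl
  le_trans u v w := by
    rintro (rfl | huv) (rfl | hvw)
    exacts [.inl rfl, .inr hvw, .inr huv, .inr (huv.trans (v.lower_le_upper.trans hvw))]
  le_antisymm u v := by
    rintro (rfl | huv) (hvu | hvu)
    · rfl
    · rfl
    · exact hvu.symm
    · have hu := huv.trans (v.lower_le_upper.trans hvu)
      have hv := hvu.trans (u.lower_le_upper.trans huv)
      cases u with
      | eye e => exact absurd hu (F.bot_lt_top e).not_ge
      | base x =>
        cases v with
        | eye e => exact absurd hv (F.bot_lt_top e).not_ge
        | base y => exact congrArg base (le_antisymm huv hvu)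

theorem le_iff {u v : F.Eyed} : u ≤ v ↔ u = v ∨ u.upper ≤ v.lower := Iff.rfl

theorem base_le_iff {x : L} {v : F.Eyed} : base x ≤ v ↔ x ≤ v.lower :=
  ⟨by rintro (rfl | h); exacts [le_rfl, h], .inr⟩

theorem le_base_iff {x : L} {v : F.Eyed} : v ≤ base x ↔ v.upper ≤ x :=
  ⟨by rintro (rfl | h); exacts [le_rfl, h], .inr⟩

theorem base_strictMono : StrictMono (base : L → F.Eyed) := fun _ _ h =>
  lt_of_le_of_ne (base_le_iff.2 h.le) fun e => h.ne (base.inj e)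

theorem base_lt_base_iff {x y : L} : (base x : F.Eyed) < base y ↔ x < y :=
  ⟨fun h => lt_of_le_of_ne (base_le_iff.1 h.le) fun e => h.ne (congrArg base e),
    fun h => base_strictMono h⟩

theorem base_lower_le (u : F.Eyed) : base u.lower ≤ u := base_le_iff.2 le_rfl

theorem le_base_upper (u : F.Eyed) : u ≤ base u.upper := le_base_iff.2 le_rfl

theorem base_bot_le_eye (e : E) : (base (F.bot e) : F.Eyed) ≤ eye e := base_le_iff.2 le_rfl

theorem eye_le_base_top (e : E) : (eye e : F.Eyed) ≤ base (F.top e) := le_base_iff.2 le_rfl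

theorem upper_le_lower_of_lt {u v : F.Eyed} (h : u < v) : u.upper ≤ v.lower :=
  (le_iff.1 h.le).resolve_left h.ne

theorem upper_mono {u v : F.Eyed} (h : u ≤ v) : u.upper ≤ v.upper :=
  le_base_iff.1 (h.trans v.le_base_upper)

theorem lower_mono {u v : F.Eyed} (h : u ≤ v) : u.lower ≤ v.lower :=
  base_le_iff.1 (u.base_lower_le.trans h)

open Classical in
noncomputable instance : Lattice F.Eyed where
  sup u v := if u ≤ v then v else if v ≤ u then u else base (u.upper ⊔ v.upper)
  inf u v := if u ≤ v then u else if v ≤ u then v else base (u.lower ⊓ v.lower)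
  le_sup_left u v := by
    split_ifs with huv hvu
    exacts [huv, le_rfl, le_base_iff.2 le_sup_left]
  le_sup_right u v := by
    split_ifs with huv hvu
    exacts [le_rfl, hvu, le_base_iff.2 le_sup_right]
  sup_le u v w hu hv := by
    split_ifs with huv hvu
    · exact hv
    · exact hu
    · refine base_le_iff.2 (sup_le (upper_le_lower_of_lt ?_) (upper_le_lower_of_lt ?_))
      exacts [hu.lt_of_ne fun e => hvu (e ▸ hv), hv.lt_of_ne fun e => huv (e ▸ hu)]
  inf_le_left u v := by
    split_ifs with huv hvu
    exacts [le_rfl, hvu, base_le_iff.2 inf_le_left]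
  inf_le_right u v := by
    split_ifs with huv hvu
    exacts [huv, le_rfl, base_le_iff.2 inf_le_right]
  le_inf u v w hv hw := by
    split_ifs with hvw hwv
    · exact hv
    · exact hw
    · refine le_base_iff.2 (le_inf (upper_le_lower_of_lt ?_) (upper_le_lower_of_lt ?_))
      exacts [hv.lt_of_ne fun e => hvw (e ▸ hw), hw.lt_of_ne fun e => hwv (e ▸ hv)]

theorem sup_eq_base {u v : F.Eyed} (huv : ¬ u ≤ v) (hvu : ¬ v ≤ u) :
    u ⊔ v = base (u.upper ⊔ v.upper) :=
  (if_neg huv).trans (if_neg hvu)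

theorem inf_eq_base {u v : F.Eyed} (huv : ¬ u ≤ v) (hvu : ¬ v ≤ u) :
    u ⊓ v = base (u.lower ⊓ v.lower) :=
  (if_neg huv).trans (if_neg hvu)

theorem upper_sup (u v : F.Eyed) : (u ⊔ v).upper = u.upper ⊔ v.upper := by
  by_cases huv : u ≤ v
  · rw [sup_eq_right.2 huv, sup_eq_right.2 (upper_mono huv)]
  by_cases hvu : v ≤ u
  · rw [sup_eq_left.2 hvu, sup_eq_left.2 (upper_mono hvu)]
  rw [sup_eq_base huv hvu, upper]

theorem lower_inf (u v : F.Eyed) : (u ⊓ v).lower = u.lower ⊓ v.lower := by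
  by_cases huv : u ≤ v
  · rw [inf_eq_left.2 huv, inf_eq_left.2 (lower_mono huv)]
  by_cases hvu : v ≤ u
  · rw [inf_eq_right.2 hvu, inf_eq_right.2 (lower_mono hvu)]
  rw [inf_eq_base huv hvu, lower]

theorem base_sup (x y : L) : (base (x ⊔ y) : F.Eyed) = base x ⊔ base y := by
  refine le_antisymm (base_le_iff.2 (sup_le ?_ ?_)) (base_strictMono.monotone.le_map_sup x y)
  exacts [base_le_iff.1 le_sup_left, base_le_iff.1 le_sup_right]

theorem base_inf (x y : L) : (base (x ⊓ y) : F.Eyed) = base x ⊓ base y := by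
  refine le_antisymm (base_strictMono.monotone.map_inf_le x y) (le_base_iff.2 (le_inf ?_ ?_))
  exacts [le_base_iff.1 inf_le_left, le_base_iff.1 inf_le_right]

theorem eye_sup_base {e : E} {x : L} (h : ¬ x ≤ F.bot e) :
    eye e ⊔ base x = (base (F.top e ⊔ x) : F.Eyed) := by
  by_cases hx : F.top e ≤ x
  · rw [sup_eq_right.2 hx, sup_eq_right.2 (le_base_iff.2 hx)]
  · exact sup_eq_base (mt le_base_iff.1 hx) (mt base_le_iff.1 h)

theorem eye_inf_base {e : E} {x : L} (h : ¬ F.top e ≤ x) :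
    eye e ⊓ base x = (base (F.bot e ⊓ x) : F.Eyed) := by
  by_cases hx : x ≤ F.bot e
  · rw [inf_eq_right.2 hx, inf_eq_right.2 (base_le_iff.2 hx)]
  · exact inf_eq_base (mt le_base_iff.1 h) (mt base_le_iff.1 hx)

theorem isDiamond (e : E) : IsDiamond (base (F.bot e)) (base (F.left e)) (base (F.right e))
    (eye e) (base (F.top e) : F.Eyed) where
  inf_ab := (base_inf _ _).symm
  inf_bc := by
    rw [inf_comm, eye_inf_base (F.right_lt_top e).not_ge, inf_eq_left.2 (F.bot_lt_right e).le]
  inf_ca := by rw [eye_inf_base (F.left_lt_top e).not_ge, inf_eq_left.2 (F.bot_lt_left e).le]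
  sup_ab := (base_sup _ _).symm
  sup_bc := by
    rw [sup_comm, eye_sup_base (F.bot_lt_right e).not_ge, sup_eq_left.2 (F.right_lt_top e).le]
  sup_ca := by rw [eye_sup_base (F.bot_lt_left e).not_ge, sup_eq_left.2 (F.left_lt_top e).le]

instance [Finite L] [Finite E] : Finite F.Eyed :=
  Finite.of_injective (fun | base x => Sum.inl x | eye e => Sum.inr e) fun u v h => by
    cases u <;> cases v <;> simp_all

section Semimodularity

theorem base_covBy_base_iff {x y : L} : (base x : F.Eyed) ⋖ base y ↔ x ⋖ y := by
  refine ⟨fun h => ⟨base_lt_base_iff.1 h.lt, fun z hxz hzy =>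
    h.2 (base_strictMono hxz) (base_strictMono hzy)⟩, fun h => ⟨base_strictMono h.lt, ?_⟩⟩
  rintro (z | e) hx hy
  · exact h.2 (base_lt_base_iff.1 hx) (base_lt_base_iff.1 hy)
  · exact h.2 ((upper_le_lower_of_lt hx).trans_lt (F.bot_lt_left e))
      ((F.left_lt_top e).trans_le (upper_le_lower_of_lt hy))

theorem eye_covBy_iff {e : E} {u : F.Eyed} : eye e ⋖ u ↔ u = base (F.top e) := by
  have h_top : (eye e : F.Eyed) ⋖ base (F.top e) :=
    ⟨(eye_le_base_top e).lt_of_ne nofun, fun _ h h' =>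
      h'.not_ge (base_le_iff.2 (upper_le_lower_of_lt h))⟩
  refine ⟨fun h => ?_, fun h => h ▸ h_top⟩
  exact ((h.eq_or_eq h_top.le (base_le_iff.2 (upper_le_lower_of_lt h.lt))).resolve_left nofun).symm

theorem eq_base_bot_of_covBy_eye {e : E} {u : F.Eyed} (h : u ⋖ eye e) : u = base (F.bot e) :=
  ((h.eq_or_eq (le_base_iff.2 (upper_le_lower_of_lt h.lt))
    (base_bot_le_eye e)).resolve_right nofun).symm

theorem isWeakUpperModularLattice [IsWeakUpperModularLattice L] (hbot : Function.Injective F.bot)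
    (htop : ∀ e z, F.bot e ⋖ z → z ⋖ F.top e) : IsWeakUpperModularLattice F.Eyed := by
  have sup_of_bot_covBy {e : E} {z : L} (h : F.bot e ⋖ z) :
      eye e ⊔ base z = (base (F.top e) : F.Eyed) := by
    rw [eye_sup_base h.lt.not_ge, sup_eq_left.2 (htop e z h).le]
  refine ⟨fun {a b} ha hb => ?_⟩
  rcases a with x | i <;> rcases b with y | j
  · rw [← base_inf, base_covBy_base_iff] at ha hb
    rw [← base_sup, base_covBy_base_iff]
    exact covBy_sup_of_inf_covBy_of_inf_covBy_left ha hb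
  · rw [eq_base_bot_of_covBy_eye hb, base_covBy_base_iff] at ha
    rw [sup_comm, sup_of_bot_covBy ha, base_covBy_base_iff]
    exact htop j x ha
  · rw [eq_base_bot_of_covBy_eye ha, base_covBy_base_iff] at hb
    rw [eye_covBy_iff, sup_of_bot_covBy hb]
  · obtain rfl : i = j :=
      hbot (base.inj ((eq_base_bot_of_covBy_eye ha).symm.trans (eq_base_bot_of_covBy_eye hb)))
    simp at ha

end Semimodularity

section Congruence

/-- The congruence of `L` induced by a congruence of the lattice with eyes. -/
def restrict (θ : LatticeCon F.Eyed) : LatticeCon L where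
  r x y := θ.r (base x) (base y)
  iseqv := ⟨fun _ => θ.iseqv.refl _, θ.iseqv.symm, θ.iseqv.trans⟩
  inf h₁ h₂ := by
    simp only [base_inf]
    exact θ.inf h₁ h₂
  sup h₁ h₂ := by
    simp only [base_sup]
    exact θ.sup h₁ h₂

theorem rel_iff_of_lt (θ : LatticeCon F.Eyed) {u v : F.Eyed} (huv : u < v) :
    θ.r u v ↔ (restrict θ).r u.lower v.upper := by
  refine ⟨fun h => ?_, latticeCon_rel_of_le_of_le θ u.base_lower_le huv.le v.le_base_upper⟩
  have h_lower : θ.r (base u.lower) u := by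
    cases u with
    | base x => exact θ.refl _
    | eye e =>
      refine (isDiamond e).rotate.rotate.rel_bot_iff_rel_self_top.2 ?_
      exact latticeCon_rel_of_le_of_le θ le_rfl (eye_le_base_top e)
        (base_le_iff.2 (upper_le_lower_of_lt huv)) h
  have h_upper : θ.r v (base v.upper) := by
    cases v with
    | base x => exact θ.refl _
    | eye e =>
      refine (isDiamond e).rotate.rotate.rel_bot_iff_rel_self_top.1 ?_
      exact latticeCon_rel_of_le_of_le θ (le_base_iff.2 (upper_le_lower_of_lt huv))
        (base_bot_le_eye e) le_rfl h
  exact θ.trans h_lower (θ.trans h h_upper)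

theorem restrict_le_restrict_iff {θ θ' : LatticeCon F.Eyed} :
    restrict θ ≤ restrict θ' ↔ θ ≤ θ' := by
  refine ⟨fun h u v huv => ?_, fun h _ _ hxy => h hxy⟩
  rcases eq_or_ne u v with rfl | hne
  · exact θ'.refl _
  · rw [← LatticeCon.r_inf_sup_iff, rel_iff_of_lt _ (inf_lt_sup.2 hne)] at huv ⊢
    exact h huv

variable (F) in
/-- The congruences of `L` that extend to the lattice with eyes: those that collapse a marked
interval as soon as they identify one end of it with an element strictly beyond that end. -/
structure Compatible (ψ : LatticeCon L) : Prop where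
  up : ∀ e z, F.bot e < z → ψ.r (F.bot e) z → ψ.r (F.bot e) (F.top e)
  down : ∀ e z, z < F.top e → ψ.r z (F.top e) → ψ.r (F.bot e) (F.top e)

theorem compatible_restrict (θ : LatticeCon F.Eyed) : Compatible F (restrict θ) where
  up e z hz h := by
    have h_sup := θ.sup (θ.refl (eye e)) h
    rw [sup_eq_left.2 (base_bot_le_eye e), eye_sup_base hz.not_ge] at h_sup
    refine (isDiamond e).rotate.rotate.rel_bot_top_iff.2
      ((isDiamond e).rotate.rotate.rel_bot_iff_rel_self_top.2 ?_)
    exact latticeCon_rel_of_le_of_le θ le_rfl (eye_le_base_top e)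
      (base_le_iff.2 le_sup_left) h_sup
  down e z hz h := by
    have h_inf := θ.inf (θ.refl (eye e)) h
    rw [inf_eq_left.2 (eye_le_base_top e), eye_inf_base hz.not_ge] at h_inf
    refine (isDiamond e).rotate.rotate.rel_bot_top_iff.2 ?_
    exact latticeCon_rel_of_le_of_le θ (le_base_iff.2 inf_le_left)
      (base_bot_le_eye e) le_rfl h_inf

variable {ψ : LatticeCon L}

theorem Compatible.rel_bot_left_iff_rel_bot_right (hψ : Compatible F ψ) (e : E) :
    ψ.r (F.bot e) (F.left e) ↔ ψ.r (F.bot e) (F.right e) :=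
  ⟨fun h => latticeCon_rel_of_le_of_le ψ le_rfl (F.bot_lt_right e).le (F.right_lt_top e).le
      (hψ.up e _ (F.bot_lt_left e) h),
    fun h => latticeCon_rel_of_le_of_le ψ le_rfl (F.bot_lt_left e).le (F.left_lt_top e).le
      (hψ.up e _ (F.bot_lt_right e) h)⟩

theorem Compatible.rel_lower_upper_sup (hψ : Compatible F ψ) {u v w : F.Eyed} (huv : u ≤ v)
    (h : ψ.r u.lower v.upper) (hvw : ¬ v ≤ w) : ψ.r (u ⊔ w).lower (v ⊔ w).upper := by
  have h_upper : ψ.r u.upper v.upper :=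
    latticeCon_rel_of_le_of_le ψ u.lower_le_upper (upper_mono huv) le_rfl h
  by_cases hwu : w ≤ u
  · rwa [sup_eq_left.2 hwu, sup_eq_left.2 (hwu.trans huv)]
  by_cases huw : u ≤ w
  · have hle : u.upper ≤ w.lower := upper_le_lower_of_lt (huw.lt_of_not_ge hwu)
    have hw : ψ.r w.lower (v.upper ⊔ w.lower) := by
      simpa only [sup_eq_right.2 hle] using ψ.sup h_upper (ψ.refl w.lower)
    rw [sup_eq_right.2 huw, upper_sup]
    cases w with
    | base x => exact hw
    | eye e =>
      have h_top := hψ.up e _ (right_lt_sup.2 fun h' => hvw (.inr h')) hw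
      exact ψ.trans hw (ψ.sup (ψ.refl v.upper) h_top)
  · rw [upper_sup, sup_eq_base huw hwu]
    exact ψ.sup h_upper (ψ.refl w.upper)

theorem Compatible.rel_lower_upper_inf (hψ : Compatible F ψ) {u v w : F.Eyed} (huv : u ≤ v)
    (h : ψ.r u.lower v.upper) (hwu : ¬ w ≤ u) : ψ.r (u ⊓ w).lower (v ⊓ w).upper := by
  have h_lower : ψ.r u.lower v.lower :=
    latticeCon_rel_of_le_of_le ψ le_rfl (lower_mono huv) v.lower_le_upper h
  by_cases hvw : v ≤ w
  · rwa [inf_eq_left.2 hvw, inf_eq_left.2 (huv.trans hvw)]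
  by_cases hwv : w ≤ v
  · have hle : w.upper ≤ v.lower := upper_le_lower_of_lt (hwv.lt_of_not_ge hvw)
    have hw : ψ.r (u.lower ⊓ w.upper) w.upper := by
      simpa only [inf_eq_right.2 hle] using ψ.inf h_lower (ψ.refl w.upper)
    rw [inf_eq_right.2 hwv, lower_inf]
    cases w with
    | base x => exact hw
    | eye e =>
      have h_bot := hψ.down e _ (inf_lt_right.2 fun h' => hwu (.inr h')) hw
      exact ψ.trans (ψ.inf (ψ.refl u.lower) h_bot) hw
  · rw [lower_inf, inf_eq_base hvw hwv]
    exact ψ.inf h_lower (ψ.refl w.lower)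

/-- The extension of a compatible congruence to the lattice with eyes. -/
noncomputable def extend (hψ : Compatible F ψ) : LatticeCon F.Eyed :=
  haveI : Std.Refl fun u v : F.Eyed => u = v ∨ ψ.r (u ⊓ v).lower (u ⊔ v).upper :=
    ⟨fun _ => .inl rfl⟩
  LatticeCon.mk' (fun u v => u = v ∨ ψ.r (u ⊓ v).lower (u ⊔ v).upper)
    (fun {u v} => by
      rw [inf_eq_left.2 (inf_le_sup : u ⊓ v ≤ u ⊔ v), sup_eq_right.2 inf_le_sup, inf_eq_sup])
    (fun {u v w} huv hvw h₁ h₂ => by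
      rcases h₁ with rfl | h₁
      · exact h₂
      rcases h₂ with rfl | h₂
      · exact .inr h₁
      rw [inf_eq_left.2 huv, sup_eq_right.2 huv] at h₁
      rw [inf_eq_left.2 hvw, sup_eq_right.2 hvw] at h₂
      rw [inf_eq_left.2 (huv.trans hvw), sup_eq_right.2 (huv.trans hvw)]
      have h_mid : ψ.r v.lower v.upper :=
        latticeCon_rel_of_le_of_le ψ (lower_mono huv) v.lower_le_upper le_rfl h₁
      exact .inr (ψ.trans h₁ (ψ.trans (ψ.symm h_mid) h₂)))
    (fun {u v w} huv h => by
      rcases h with rfl | h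
      · exact ⟨.inl rfl, .inl rfl⟩
      rw [inf_eq_left.2 huv, sup_eq_right.2 huv] at h
      rw [inf_eq_left.2 (inf_le_inf_right w huv), sup_eq_right.2 (inf_le_inf_right w huv),
        inf_eq_left.2 (sup_le_sup_right huv w), sup_eq_right.2 (sup_le_sup_right huv w)]
      refine ⟨or_iff_not_imp_left.2 fun hne => hψ.rel_lower_upper_inf huv h fun hw => hne ?_,
        or_iff_not_imp_left.2 fun hne => hψ.rel_lower_upper_sup huv h fun hw => hne ?_⟩
      · rw [inf_eq_right.2 hw, inf_eq_right.2 (hw.trans huv)]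
      · rw [sup_eq_right.2 hw, sup_eq_right.2 (huv.trans hw)])

theorem restrict_extend (hψ : Compatible F ψ) : restrict (extend hψ) = ψ := by
  have key (x y : L) : (extend hψ).r (base x) (base y) ↔ ψ.r x y := by
    change base x = base y ∨ ψ.r (base x ⊓ base y : F.Eyed).lower (base x ⊔ base y : F.Eyed).upper
      ↔ ψ.r x y
    rw [lower_inf, upper_sup]
    refine ⟨?_, fun h => .inr (ψ.r_inf_sup_iff.2 h)⟩
    rintro (h | h)
    exacts [base.inj h ▸ ψ.refl x, ψ.r_inf_sup_iff.1 h]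
  exact le_antisymm (fun x y => (key x y).1) fun x y => (key x y).2

variable (F) in
/-- The congruences of the lattice with eyes are the compatible congruences of `L`. -/
noncomputable def conIso : LatticeCon F.Eyed ≃o {ψ : LatticeCon L // Compatible F ψ} :=
  RelIso.ofSurjective
    (OrderEmbedding.ofMapLEIff (fun θ => ⟨restrict θ, compatible_restrict θ⟩)
      fun _ _ => restrict_le_restrict_iff)
    fun ψ => ⟨extend ψ.2, Subtype.ext (restrict_extend ψ.2)⟩

end Congruence

end Eyed

end EyeFamily

/-! ### The grid of a chain with forks -/

/-- A finite chain `0 < 1 < ⋯ < N` with isolated inner points marked as forks; its square will get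
a fork on the diagonal at each marked point. -/
structure ForkedChain where
  N : ℕ
  Fork : ℕ → Prop
  pos : ∀ {x}, Fork x → 0 < x
  lt : ∀ {x}, Fork x → x < N
  isolated : ∀ {x}, Fork x → ¬ Fork (x + 1)

namespace ForkedChain

variable (C : ForkedChain)

/-- Membership in the grid of the chain: its points are those of the square of the chain, except
that inserting a fork on the diagonal at `(k, k)` removes the points `(k, b)` and `(b, k)` with
`k < b`. -/
def Mem (a b : ℕ) : Prop :=
  a ≤ C.N ∧ b ≤ C.N ∧ (C.Fork a → b ≤ a) ∧ (C.Fork b → a ≤ b)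

/-- The grid of the chain, ordered componentwise: the direct square with a fork inserted on the
diagonal at each marked point. -/
@[ext]
structure Grid where
  x : ℕ
  y : ℕ
  mem : C.Mem x y

open Classical in
/-- The first coordinate of the smallest point of the grid above `(a, b)`. -/
noncomputable def bump (a b : ℕ) : ℕ := if C.Fork a ∧ a < b then a + 1 else a

variable {C}

theorem Mem.inf {a b a' b' : ℕ} (h : C.Mem a b) (h' : C.Mem a' b') :
    C.Mem (min a a') (min b b') := by
  grind [Mem]

theorem mem_zero_right {a : ℕ} (ha : a ≤ C.N) : C.Mem a 0 :=
  ⟨ha, C.N.zero_le, fun _ => a.zero_le, fun h => absurd (C.pos h) (lt_irrefl 0)⟩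

theorem mem_zero_left {b : ℕ} (hb : b ≤ C.N) : C.Mem 0 b :=
  ⟨C.N.zero_le, hb, fun h => absurd (C.pos h) (lt_irrefl 0), fun _ => b.zero_le⟩

theorem mem_bump {a b : ℕ} (ha : a ≤ C.N) (hb : b ≤ C.N) :
    C.Mem (C.bump a b) (C.bump b a) := by
  grind [Mem, bump, C.lt, C.isolated]

theorem bump_le_and_bump_le_iff {a b x y : ℕ} (h : C.Mem x y) :
    C.bump a b ≤ x ∧ C.bump b a ≤ y ↔ a ≤ x ∧ b ≤ y := by
  grind [Mem, bump]

namespace Grid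

instance : PartialOrder C.Grid :=
  PartialOrder.lift (fun p => (p.x, p.y)) fun _ _ h =>
    Grid.ext (congrArg Prod.fst h) (congrArg Prod.snd h)

theorem le_iff {p q : C.Grid} : p ≤ q ↔ p.x ≤ q.x ∧ p.y ≤ q.y := Iff.rfl

variable (C) in
/-- The smallest point of the grid above `(a, b)`, where coordinates above `C.N` count as `C.N`. -/
noncomputable def pt (a b : ℕ) : C.Grid :=
  ⟨_, _, C.mem_bump (min_le_right a C.N) (min_le_right b C.N)⟩

theorem pt_le_iff {a b : ℕ} {p : C.Grid} :
    pt C a b ≤ p ↔ min a C.N ≤ p.x ∧ min b C.N ≤ p.y :=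
  bump_le_and_bump_le_iff p.mem

theorem le_pt_iff {a b : ℕ} (h : C.Mem a b) {p : C.Grid} : p ≤ pt C a b ↔ p.x ≤ a ∧ p.y ≤ b := by
  grind [le_iff, pt, Mem, bump]

theorem pt_eq_of_mem {a b : ℕ} (h : C.Mem a b) : pt C a b = ⟨a, b, h⟩ :=
  eq_of_forall_le_iff fun _ => le_pt_iff h

theorem pt_x_y (p : C.Grid) : pt C p.x p.y = p := pt_eq_of_mem p.mem

theorem min_le_pt_x_and_min_le_pt_y (a b : ℕ) :
    min a C.N ≤ (pt C a b).x ∧ min b C.N ≤ (pt C a b).y :=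
  pt_le_iff.1 le_rfl

theorem pt_mono {a b a' b' : ℕ} (ha : a ≤ a') (hb : b ≤ b') : pt C a b ≤ pt C a' b' := by
  have := min_le_pt_x_and_min_le_pt_y (C := C) a' b'
  exact pt_le_iff.2 (by omega)

noncomputable instance : Lattice C.Grid where
  inf p q := ⟨_, _, p.mem.inf q.mem⟩
  sup p q := pt C (max p.x q.x) (max p.y q.y)
  inf_le_left _ _ := ⟨min_le_left _ _, min_le_left _ _⟩
  inf_le_right _ _ := ⟨min_le_right _ _, min_le_right _ _⟩
  le_inf _ _ _ h h' := ⟨le_min h.1 h'.1, le_min h.2 h'.2⟩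
  le_sup_left p _ := (pt_x_y p).ge.trans (pt_mono (le_max_left _ _) (le_max_left _ _))
  le_sup_right _ q := (pt_x_y q).ge.trans (pt_mono (le_max_right _ _) (le_max_right _ _))
  sup_le _ _ _ h h' :=
    pt_le_iff.2 ⟨min_le_of_left_le (max_le h.1 h'.1), min_le_of_left_le (max_le h.2 h'.2)⟩

theorem pt_sup_pt (a b a' b' : ℕ) : pt C a b ⊔ pt C a' b' = pt C (max a a') (max b b') := by
  refine eq_of_forall_ge_iff fun p => ?_
  rw [sup_le_iff, pt_le_iff, pt_le_iff, pt_le_iff]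
  omega

theorem pt_inf_pt {a b a' b' : ℕ} (h : C.Mem a b) (h' : C.Mem a' b') :
    pt C a b ⊓ pt C a' b' = pt C (min a a') (min b b') := by
  rw [pt_eq_of_mem h, pt_eq_of_mem h', pt_eq_of_mem (h.inf h')]
  rfl

instance : Finite C.Grid :=
  have : Finite {p : ℕ × ℕ // p.1 ≤ C.N ∧ p.2 ≤ C.N} :=
    ((Set.finite_Iic C.N).prod (Set.finite_Iic C.N)).to_subtype
  Finite.of_injective
    (fun p : C.Grid => (⟨(p.x, p.y), p.mem.1, p.mem.2.1⟩ : {p : ℕ × ℕ // p.1 ≤ C.N ∧ p.2 ≤ C.N}))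
    fun _ _ h => Grid.ext (congrArg (·.1.1) h) (congrArg (·.1.2) h)

theorem pt_wcovBy_pt_succ_right (a b : ℕ) : pt C a b ⩿ pt C a (b + 1) := by
  refine ⟨pt_mono le_rfl b.le_succ, fun w hw hw' => ?_⟩
  have hlow := pt_le_iff.1 hw.le
  have hhigh := le_iff.1 hw'.le
  have hnot_le := mt le_iff.2 hw.not_ge
  have hnot_ge := mt pt_le_iff.2 hw'.not_ge
  have := min_le_pt_x_and_min_le_pt_y (C := C) a b
  -- Here `w` must have been bumped to `a + 1`, so `a = b` is a fork, but then `w = (a + 1, a)`.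
  grind [w.mem, Mem, pt, bump]

theorem pt_wcovBy_pt_succ_left (a b : ℕ) : pt C a b ⩿ pt C (a + 1) b := by
  refine ⟨pt_mono a.le_succ le_rfl, fun w hw hw' => ?_⟩
  have hlow := pt_le_iff.1 hw.le
  have hhigh := le_iff.1 hw'.le
  have hnot_le := mt le_iff.2 hw.not_ge
  have hnot_ge := mt pt_le_iff.2 hw'.not_ge
  have := min_le_pt_x_and_min_le_pt_y (C := C) a b
  grind [w.mem, Mem, pt, bump]

theorem eq_pt_of_covBy {c z : C.Grid} (h : c ⋖ z) :
    z = pt C (c.x + 1) c.y ∨ z = pt C c.x (c.y + 1) := by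
  have hle := le_iff.1 h.le
  have hnot_le := mt le_iff.2 h.lt.not_ge
  by_cases hx : c.x < z.x
  · refine .inl ((h.eq_or_eq ((pt_x_y c).ge.trans (pt_mono c.x.le_succ le_rfl))
      (pt_le_iff.2 (by omega))).resolve_left fun e => ?_).symm
    have := min_le_pt_x_and_min_le_pt_y (C := C) (c.x + 1) c.y
    grind [z.mem, Mem]
  · refine .inr ((h.eq_or_eq ((pt_x_y c).ge.trans (pt_mono le_rfl c.y.le_succ))
      (pt_le_iff.2 (by omega))).resolve_left fun e => ?_).symm
    have := min_le_pt_x_and_min_le_pt_y (C := C) c.x (c.y + 1)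
    grind [z.mem, Mem]

theorem pt_succ_left_sup_pt_succ_right (a b : ℕ) :
    pt C (a + 1) b ⊔ pt C a (b + 1) = pt C (a + 1) (b + 1) := by
  rw [pt_sup_pt, max_eq_left a.le_succ, max_eq_right b.le_succ]

instance : IsWeakUpperModularLattice C.Grid where
  covBy_sup_of_inf_covBy_covBy {a b} ha hb := by
    have hlt : a < a ⊔ b := left_lt_sup.2 fun h => hb.lt.ne (inf_eq_right.2 h)
    have hne : a ≠ b := fun h => ha.lt.ne (h ▸ inf_idem a)
    generalize a ⊓ b = c at ha hb
    obtain rfl | rfl := eq_pt_of_covBy ha <;> obtain rfl | rfl := eq_pt_of_covBy hb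
    · exact absurd rfl hne
    · rw [pt_succ_left_sup_pt_succ_right] at hlt ⊢
      exact (pt_wcovBy_pt_succ_right _ _).covBy_of_lt hlt
    · rw [sup_comm, pt_succ_left_sup_pt_succ_right] at hlt ⊢
      exact (pt_wcovBy_pt_succ_left _ _).covBy_of_lt hlt
    · exact absurd rfl hne

end Grid

/-! ### Eyes in the cells of the grid -/

/-- The cells of the grid: squares of the direct square of the chain all of whose corners belong
to the grid, given by their bottoms. These are the intervals into which eyes are inserted. -/
@[ext]
structure Cell (C : ForkedChain) where
  x : ℕ
  y : ℕ
  mem_bot : C.Mem x y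
  mem_left : C.Mem x (y + 1)
  mem_right : C.Mem (x + 1) y
  mem_top : C.Mem (x + 1) (y + 1)

namespace Cell

open Grid EyeFamily EyeFamily.Eyed

instance : Finite C.Cell :=
  Finite.of_injective (fun e : C.Cell => (⟨e.x, e.y, e.mem_bot⟩ : C.Grid)) fun _ _ h =>
    Cell.ext (congrArg Grid.x h) (congrArg Grid.y h)

/-- The family of the eyes to be inserted into the cells in `S`. -/
def eyes (S : Set C.Cell) : EyeFamily C.Grid S where
  left e := ⟨_, _, e.1.mem_left⟩
  right e := ⟨_, _, e.1.mem_right⟩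
  not_left_le e h := e.1.y.not_succ_le_self h.2
  not_right_le e h := e.1.x.not_succ_le_self h.1

variable {S : Set C.Cell} (e : S)

theorem eyes_left : (eyes S).left e = pt C e.1.x (e.1.y + 1) := (pt_eq_of_mem e.1.mem_left).symm

theorem eyes_right : (eyes S).right e = pt C (e.1.x + 1) e.1.y := (pt_eq_of_mem e.1.mem_right).symm

theorem eyes_bot : (eyes S).bot e = ⟨e.1.x, e.1.y, e.1.mem_bot⟩ :=
  Grid.ext (min_eq_left e.1.x.le_succ) (min_eq_right e.1.y.le_succ)

theorem eyes_top : (eyes S).top e = ⟨e.1.x + 1, e.1.y + 1, e.1.mem_top⟩ := by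
  rw [EyeFamily.top, eyes_left, eyes_right, sup_comm, pt_succ_left_sup_pt_succ_right,
    pt_eq_of_mem e.1.mem_top]

theorem covBy_eyes_top {z : C.Grid} (h : (eyes S).bot e ⋖ z) : z ⋖ (eyes S).top e := by
  rw [eyes_top, ← pt_eq_of_mem e.1.mem_top]
  rw [eyes_bot] at h
  obtain rfl | rfl := eq_pt_of_covBy h
  · refine (pt_wcovBy_pt_succ_right _ _).covBy_of_ne fun h => ?_
    rw [pt_eq_of_mem e.1.mem_right, pt_eq_of_mem e.1.mem_top] at h
    exact e.1.y.succ_ne_self (congrArg Grid.y h).symm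
  · refine (pt_wcovBy_pt_succ_left _ _).covBy_of_ne fun h => ?_
    rw [pt_eq_of_mem e.1.mem_left, pt_eq_of_mem e.1.mem_top] at h
    exact e.1.x.succ_ne_self (congrArg Grid.x h).symm

instance : IsWeakUpperModularLattice (eyes S).Eyed := by
  refine isWeakUpperModularLattice (fun e e' h => Subtype.ext ?_) fun e _ => covBy_eyes_top e
  rw [eyes_bot, eyes_bot, Grid.mk.injEq] at h
  exact Cell.ext h.1 h.2

/-- The embedding of the grid with eyes into a product of two chains: in both coordinates the eye of
a cell lies strictly between the two sides of the cell, and the second components of the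
lexicographic products make eyes in the same row or column incomparable. -/
noncomputable def orderEmbedding (S : Set C.Cell) :
    (eyes S).Eyed ↪o (ℤ ×ₗ ℤ) × (ℤ ×ₗ ℤ) :=
  OrderEmbedding.ofMapLEIff
    (fun
      | base p => (toLex (2 * p.x, 0), toLex (2 * p.y, 0))
      | eye e => (toLex (2 * e.1.x + 1, -e.1.y), toLex (2 * e.1.y + 1, -e.1.x)))
    fun
      | base p, base q => by
        simp only [Prod.mk_le_mk, Prod.Lex.toLex_le_toLex, base_le_iff, lower, Grid.le_iff]
        omega
      | base p, eye e => by
        simp only [Prod.mk_le_mk, Prod.Lex.toLex_le_toLex, base_le_iff, lower, eyes_bot,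
          Grid.le_iff]
        omega
      | eye e, base p => by
        simp only [Prod.mk_le_mk, Prod.Lex.toLex_le_toLex, le_base_iff, upper, eyes_top,
          Grid.le_iff]
        omega
      | eye e, eye e' => by
        simp only [Prod.mk_le_mk, Prod.Lex.toLex_le_toLex, Eyed.le_iff, eye.injEq, Subtype.ext_iff,
          Cell.ext_iff, lower, upper, eyes_bot, eyes_top, Grid.le_iff]
        omega

theorem isPlanarOrder_eyed (S : Set C.Cell) : IsPlanarOrder (eyes S).Eyed :=
  have : Countable (ℤ ×ₗ ℤ) := inferInstanceAs (Countable (ℤ × ℤ))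
  isPlanarOrder_of_orderEmbedding_prod (orderEmbedding S)

end Cell

/-! ### Congruences of the grid -/

variable (C) in
/-- A set of steps `t → t + 1` of the chain that contains the step after a fork if it contains the
step before it, as is the case for the steps collapsed by a congruence of the grid. -/
def IsForkClosed (S : Set ℕ) : Prop := ∀ ⦃k⦄, C.Fork (k + 1) → k ∈ S → k + 1 ∈ S

section Bump

variable {S : Set ℕ} {a a' b b' : ℕ}

theorem stepCon_rel_bump_right (h : (stepCon S).r b b') :
    (stepCon S).r (C.bump a b) (C.bump a b') := by
  wlog hle : b ≤ b' generalizing b b'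
  · exact (stepCon S).symm (this ((stepCon S).symm h) (le_of_not_ge hle))
  rw [stepCon_rel_of_le hle] at h
  have : C.bump a b ≤ C.bump a b' := by grind [bump]
  rw [stepCon_rel_of_le this]
  grind [bump]

theorem stepCon_rel_bump_left (hS : C.IsForkClosed S)
    (h : (stepCon S).r a a') : (stepCon S).r (C.bump a b) (C.bump a' b) := by
  wlog hle : a ≤ a' generalizing a a'
  · exact (stepCon S).symm (this ((stepCon S).symm h) (le_of_not_ge hle))
  obtain rfl | hlt := hle.eq_or_lt
  · exact (stepCon S).refl _
  rw [stepCon_rel_of_le hle] at h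
  have : C.bump a b ≤ C.bump a' b := by grind [bump]
  rw [stepCon_rel_of_le this]
  have := @hS (a' - 1)
  grind [bump]

end Bump

namespace Grid

/-- The congruence of the grid that collapses the steps `t → t + 1` with `t ∈ S` in both
coordinates. -/
noncomputable def con (S : Set ℕ) (hS : C.IsForkClosed S) : LatticeCon C.Grid where
  r p q := (stepCon S).r p.x q.x ∧ (stepCon S).r p.y q.y
  iseqv := ⟨fun _ => ⟨(stepCon S).refl _, (stepCon S).refl _⟩,
    fun h => ⟨(stepCon S).symm h.1, (stepCon S).symm h.2⟩,
    fun h h' => ⟨(stepCon S).trans h.1 h'.1, (stepCon S).trans h.2 h'.2⟩⟩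
  inf h h' := ⟨(stepCon S).inf h.1 h'.1, (stepCon S).inf h.2 h'.2⟩
  sup h h' := by
    have hx := (stepCon S).inf ((stepCon S).sup h.1 h'.1) ((stepCon S).refl C.N)
    have hy := (stepCon S).inf ((stepCon S).sup h.2 h'.2) ((stepCon S).refl C.N)
    exact ⟨(stepCon S).trans (stepCon_rel_bump_left hS hx) (stepCon_rel_bump_right hy),
      (stepCon S).trans (stepCon_rel_bump_left hS hy) (stepCon_rel_bump_right hx)⟩

theorem pt_eq_pt_succ_left {k b : ℕ} (hk : C.Fork k) (hb : k < b) : pt C k b = pt C (k + 1) b := by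
  refine eq_of_forall_ge_iff fun p => ?_
  rw [pt_le_iff, pt_le_iff]
  grind [p.mem, Mem, C.lt hk]

theorem pt_eq_pt_succ_right {k a : ℕ} (hk : C.Fork k) (ha : k < a) :
    pt C a k = pt C a (k + 1) := by
  refine eq_of_forall_ge_iff fun p => ?_
  rw [pt_le_iff, pt_le_iff]
  grind [p.mem, Mem, C.lt hk]

variable (ψ : LatticeCon C.Grid)

/-- The steps `t → t + 1` of the first coordinate that a congruence collapses. -/
def rowSteps : Set ℕ := {t | ψ.r (pt C t 0) (pt C (t + 1) 0)}

/-- The steps `t → t + 1` of the second coordinate that a congruence collapses. -/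
def colSteps : Set ℕ := {t | ψ.r (pt C 0 t) (pt C 0 (t + 1))}

theorem rel_iff_stepCon_rel {p q : C.Grid} :
    ψ.r p q ↔ (stepCon (rowSteps ψ)).r p.x q.x ∧ (stepCon (colSteps ψ)).r p.y q.y := by
  have hrow := latticeCon_rel_iff_stepCon_rel ψ (s := fun t => pt C t 0)
    (fun _ _ h => pt_mono h le_rfl) p.x q.x
  have hcol := latticeCon_rel_iff_stepCon_rel ψ (s := fun t => pt C 0 t)
    (fun _ _ h => pt_mono le_rfl h) p.y q.y
  have inf_row (p : C.Grid) : p ⊓ pt C C.N 0 = pt C p.x 0 := by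
    rw [← pt_x_y p, pt_inf_pt p.mem (mem_zero_right le_rfl), pt_x_y, min_eq_left p.mem.1,
      Nat.min_zero]
  have inf_col (p : C.Grid) : p ⊓ pt C 0 C.N = pt C 0 p.y := by
    rw [← pt_x_y p, pt_inf_pt p.mem (mem_zero_left le_rfl), pt_x_y, min_eq_left p.mem.2.1,
      Nat.min_zero]
  have sup_row_col (p : C.Grid) : pt C p.x 0 ⊔ pt C 0 p.y = p := by
    rw [pt_sup_pt, Nat.max_zero, Nat.zero_max, pt_x_y]
  refine ⟨fun h => ⟨hrow.1 ?_, hcol.1 ?_⟩, fun h => ?_⟩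
  · simpa only [inf_row] using ψ.inf h (ψ.refl (pt C C.N 0))
  · simpa only [inf_col] using ψ.inf h (ψ.refl (pt C 0 C.N))
  · simpa only [sup_row_col] using ψ.sup (hrow.2 h.1) (hcol.2 h.2)

variable {ψ}

theorem le_of_rowSteps_of_colSteps {ψ' : LatticeCon C.Grid}
    (hrow : ∀ t < C.N, t ∈ rowSteps ψ → t ∈ rowSteps ψ')
    (hcol : ∀ t < C.N, t ∈ colSteps ψ → t ∈ colSteps ψ') : ψ ≤ ψ' := fun p q h => by
  rw [rel_iff_stepCon_rel] at h ⊢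
  exact ⟨fun t ht ht' => hrow t (ht'.trans_le (max_le p.mem.1 q.mem.1)) (h.1 t ht ht'),
    fun t ht ht' => hcol t (ht'.trans_le (max_le p.mem.2.1 q.mem.2.1)) (h.2 t ht ht')⟩

theorem rel_iff_of_row {a a' b : ℕ} (haa' : a ≤ a') (h : C.Mem a b) (ha' : a' ≤ C.N) :
    ψ.r (pt C a b) (pt C a' b) ↔ ψ.r (pt C a 0) (pt C a' 0) := by
  have := latticeCon_rel_inf_iff_rel_sup ψ (pt C a' 0) (pt C a b)
  rw [pt_inf_pt (mem_zero_right ha') h, pt_sup_pt] at this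
  simpa [haa'] using this.symm

theorem rel_iff_of_col {a b b' : ℕ} (hbb' : b ≤ b') (h : C.Mem a b) (hb' : b' ≤ C.N) :
    ψ.r (pt C a b) (pt C a b') ↔ ψ.r (pt C 0 b) (pt C 0 b') := by
  have := latticeCon_rel_inf_iff_rel_sup ψ (pt C 0 b') (pt C a b)
  rw [pt_inf_pt (mem_zero_left hb') h, pt_sup_pt] at this
  simpa [hbb'] using this.symm

theorem mem_rowSteps_iff_mem_colSteps_of_fork {k : ℕ} (hk : C.Fork k) :
    k ∈ rowSteps ψ ↔ k ∈ colSteps ψ := by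
  have hmem : C.Mem k k := ⟨(C.lt hk).le, (C.lt hk).le, fun _ => le_rfl, fun _ => le_rfl⟩
  refine (rel_iff_of_row k.le_succ hmem (C.lt hk)).symm.trans
    (Iff.trans ?_ (rel_iff_of_col k.le_succ hmem (C.lt hk)))
  rw [pt_eq_pt_succ_right hk k.lt_succ_self, pt_eq_pt_succ_left hk k.lt_succ_self]

theorem isForkClosed_rowSteps : C.IsForkClosed (rowSteps ψ) := fun k hk h => by
  have hlt := C.lt hk
  have hmem : C.Mem k (k + 2) := by grind [Mem, C.isolated hk, @C.isolated k]
  have hstep : ψ.r (pt C k (k + 2)) (pt C (k + 2) (k + 2)) := by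
    rw [← pt_eq_pt_succ_left hk (by omega)]
    exact (rel_iff_of_row k.le_succ hmem (by omega)).2 h
  have hrow : ψ.r (pt C k 0) (pt C (k + 2) 0) := (rel_iff_of_row (by omega) hmem (by omega)).1 hstep
  exact latticeCon_rel_of_le_of_le ψ (pt_mono (by omega) le_rfl) (pt_mono (by omega) le_rfl) le_rfl
    hrow

theorem mem_rowSteps_con_iff {S : Set ℕ} (hS : C.IsForkClosed S) {t : ℕ} (ht : t < C.N) :
    t ∈ rowSteps (con S hS) ↔ t ∈ S := by
  rw [rowSteps, Set.mem_ofPred, pt_eq_of_mem (mem_zero_right ht.le),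
    pt_eq_of_mem (mem_zero_right ht)]
  exact (and_iff_left ((stepCon S).refl 0)).trans stepCon_rel_succ

end Grid

namespace Cell

open Grid EyeFamily

variable {S : Set C.Cell} {ψ : LatticeCon C.Grid}

theorem mem_rowSteps_iff_mem_colSteps (hψ : Eyed.Compatible (eyes S) ψ) (e : S) :
    e.1.x ∈ rowSteps ψ ↔ e.1.y ∈ colSteps ψ := by
  have h := hψ.rel_bot_left_iff_rel_bot_right e
  rw [eyes_bot, ← pt_eq_of_mem, eyes_left, eyes_right,
    rel_iff_of_col (Nat.le_succ _) e.1.mem_bot e.1.mem_left.2.1,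
    rel_iff_of_row (Nat.le_succ _) e.1.mem_bot e.1.mem_right.1] at h
  exact h.symm

theorem compatible_con {S : Set ℕ} (hS : C.IsForkClosed S) {T : Set C.Cell}
    (hT : ∀ e ∈ T, e.x ∈ S ↔ e.y ∈ S) : Eyed.Compatible (eyes T) (con S hS) := by
  have collapsed_of_mem (e : T) (h : e.1.x ∈ S ∨ e.1.y ∈ S) :
      (con S hS).r ((eyes T).bot e) ((eyes T).top e) := by
    have := hT e e.2
    rw [eyes_bot, eyes_top]
    exact ⟨stepCon_rel_succ.2 (by tauto), stepCon_rel_succ.2 (by tauto)⟩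
  constructor
  · intro e z hz h
    apply collapsed_of_mem
    rw [eyes_bot] at hz h
    have hle := Grid.le_iff.1 hz.le
    have hnot_le := mt Grid.le_iff.2 hz.not_ge
    by_cases hx : e.1.x < z.x
    · exact .inl (h.1 _ (by grind) (by grind))
    · exact .inr (h.2 _ (by grind) (by grind))
  · intro e z hz h
    apply collapsed_of_mem
    rw [eyes_top] at hz h
    have hle := Grid.le_iff.1 hz.le
    have hnot_le := mt Grid.le_iff.2 hz.not_ge
    by_cases hx : z.x < e.1.x + 1
    · exact .inl (h.1 _ (by grind) (by grind))
    · exact .inr (h.2 _ (by grind) (by grind))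

end Cell

end ForkedChain

/-! ### Coloured chains -/

/-- A chain with forks whose steps `x → x + 1` are coloured by the elements of a preorder `P`. The
first `n` steps show all colours, and the other steps come in pairs around a fork which realize
the relation of `P`. -/
structure ColoredChain (P : Type*) [Preorder P] extends ForkedChain where
  n : ℕ
  color : ℕ → P
  n_le : n ≤ N
  lt_of_fork : ∀ {x}, Fork x → n < x
  fork_or : ∀ {x}, n ≤ x → x < N → Fork (x + 1) ∨ Fork x
  color_succ_le : ∀ {x}, Fork (x + 1) → color (x + 1) ≤ color x
  exists_color : ∀ p, ∃ x < n, color x = p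
  exists_fork : ∀ {p q}, p ≤ q → ∃ x, Fork (x + 1) ∧ color x = q ∧ color (x + 1) = p

namespace ColoredChain

open ForkedChain ForkedChain.Grid EyeFamily

section Con

variable {P : Type*} [Preorder P] (C : ColoredChain P)

/-- The cells of the grid that get an eye: those whose sides have the same colour. -/
def monoCells : Set C.Cell := {e | C.color e.x = C.color e.y}

/-- The lattice constructed from a coloured chain. -/
abbrev Lat : Type := (Cell.eyes C.monoCells).Eyed

variable {C} {ψ : LatticeCon C.Grid} (hψ : Eyed.Compatible (Cell.eyes C.monoCells) ψ)

include hψ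

theorem mem_rowSteps_iff_mem_colSteps_of_lt {x z : ℕ} (hx : x < C.N) (hz : z < C.n)
    (h : C.color x = C.color z) : x ∈ rowSteps ψ ↔ z ∈ colSteps ψ := by
  have hn := C.n_le
  have not_fork {y : ℕ} (hy : y ≤ C.n) (hf : C.Fork y) : False := hy.not_gt (C.lt_of_fork hf)
  let e : C.Cell :=
    { x := x
      y := z
      mem_bot := by grind [Mem]
      mem_left := by grind [Mem]
      mem_right := by grind [Mem]
      mem_top := by grind [Mem] }
  exact Cell.mem_rowSteps_iff_mem_colSteps hψ ⟨e, h⟩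

theorem mem_rowSteps_iff_of_color_eq {x y : ℕ} (hx : x < C.N) (hy : y < C.N)
    (h : C.color x = C.color y) : x ∈ rowSteps ψ ↔ y ∈ rowSteps ψ := by
  obtain ⟨z, hz, hxz⟩ := C.exists_color (C.color x)
  rw [mem_rowSteps_iff_mem_colSteps_of_lt hψ hx hz hxz.symm,
    mem_rowSteps_iff_mem_colSteps_of_lt hψ hy hz (h.symm.trans hxz.symm)]

theorem mem_rowSteps_iff_mem_colSteps_of_fork_succ {x : ℕ} (hx : C.Fork (x + 1)) :
    x ∈ rowSteps ψ ↔ x ∈ colSteps ψ := by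
  have hlt := C.lt hx
  have hnot := mt C.isolated (not_not.2 hx)
  let e : C.Cell :=
    { x := x
      y := x
      mem_bot := by grind [Mem]
      mem_left := by grind [Mem]
      mem_right := by grind [Mem]
      mem_top := by grind [Mem] }
  exact Cell.mem_rowSteps_iff_mem_colSteps hψ ⟨e, rfl⟩

theorem mem_rowSteps_iff_mem_colSteps {x : ℕ} (hx : x < C.N) :
    x ∈ rowSteps ψ ↔ x ∈ colSteps ψ := by
  obtain h | h := lt_or_ge x C.n
  · exact mem_rowSteps_iff_mem_colSteps_of_lt hψ hx h rfl
  obtain h | h := C.fork_or h hx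
  · exact mem_rowSteps_iff_mem_colSteps_of_fork_succ hψ h
  · exact mem_rowSteps_iff_mem_colSteps_of_fork h

/-- The colours of the steps that a congruence collapses. -/
def colors : LowerSet P where
  carrier := {p | ∃ x < C.N, C.color x = p ∧ x ∈ rowSteps ψ}
  lower' := by
    rintro p q hqp ⟨x, hx, rfl, h⟩
    obtain ⟨k, hk, hkx, rfl⟩ := C.exists_fork hqp
    have hlt := C.lt hk
    have hk_mem := (mem_rowSteps_iff_of_color_eq hψ hx (by omega) hkx.symm).1 h
    exact ⟨k + 1, hlt, rfl, isForkClosed_rowSteps hk hk_mem⟩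

theorem color_mem_colors_iff {x : ℕ} (hx : x < C.N) :
    C.color x ∈ colors hψ ↔ x ∈ rowSteps ψ :=
  ⟨fun ⟨_, hy, hyx, h⟩ => (mem_rowSteps_iff_of_color_eq hψ hy hx hyx).1 h,
    fun h => ⟨x, hx, rfl, h⟩⟩

theorem colors_le_colors_iff {ψ' : LatticeCon C.Grid}
    (hψ' : Eyed.Compatible (Cell.eyes C.monoCells) ψ') : colors hψ ≤ colors hψ' ↔ ψ ≤ ψ' := by
  refine ⟨fun h => ?_, fun h _ ⟨x, hx, hxp, hmem⟩ => ⟨x, hx, hxp, h hmem⟩⟩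
  have hrow : ∀ t < C.N, t ∈ rowSteps ψ → t ∈ rowSteps ψ' := fun t ht hmem =>
    (color_mem_colors_iff hψ' ht).1 (h ((color_mem_colors_iff hψ ht).2 hmem))
  exact le_of_rowSteps_of_colSteps hrow fun t ht hmem =>
    (mem_rowSteps_iff_mem_colSteps hψ' ht).1
      (hrow t ht ((mem_rowSteps_iff_mem_colSteps hψ ht).2 hmem))

omit hψ in
variable (C) in
theorem exists_colors_eq (I : LowerSet P) :
    ∃ (ψ : LatticeCon C.Grid) (hψ : Eyed.Compatible (Cell.eyes C.monoCells) ψ), colors hψ = I := by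
  have hI : C.IsForkClosed (C.color ⁻¹' I) := fun _ hk h => I.lower (C.color_succ_le hk) h
  have hcells : ∀ e ∈ C.monoCells, e.x ∈ C.color ⁻¹' I ↔ e.y ∈ C.color ⁻¹' I := fun e he => by
    rw [Set.mem_preimage, Set.mem_preimage, show C.color e.x = C.color e.y from he]
  refine ⟨con _ hI, Cell.compatible_con hI hcells, SetLike.ext fun p => ?_⟩
  obtain ⟨x, hx, rfl⟩ := C.exists_color p
  have hxN := hx.trans_le C.n_le
  exact (color_mem_colors_iff _ hxN).trans (mem_rowSteps_con_iff hI hxN)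

omit hψ in
variable (C) in
/-- The congruences of the lattice correspond to the lower sets of colours that they collapse. -/
noncomputable def conIso : LatticeCon C.Lat ≃o LowerSet P :=
  (Eyed.conIso _).trans <| RelIso.ofSurjective
    (OrderEmbedding.ofMapLEIff
      (fun ψ : {ψ // Eyed.Compatible (Cell.eyes C.monoCells) ψ} => colors ψ.2)
      fun ψ ψ' => colors_le_colors_iff ψ.2 ψ'.2)
    fun I =>
      have ⟨ψ, hψ, h⟩ := C.exists_colors_eq I
      ⟨⟨ψ, hψ⟩, h⟩

end Con

end ColoredChain

/-! ### Existence of coloured chains -/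

theorem exists_nat_enumeration (α : Type*) [Finite α] [Nonempty α] :
    ∃ (n : ℕ) (g : ℕ → α), ∀ a, ∃ i < n, g i = a := by
  obtain ⟨n, ⟨e⟩⟩ := Finite.exists_equiv_fin α
  refine ⟨n, fun i => if h : i < n then e.symm ⟨i, h⟩ else Classical.arbitrary α,
    fun a => ⟨e a, (e a).2, ?_⟩⟩
  simp

/-- The colouring of `ℕ` whose first `n` colours are those of `g`, followed by the pairs `k 0`,
`k 1`, …, each with its second component first. -/
def enumColor {P : Type*} (n : ℕ) (g : ℕ → P) (k : ℕ → P × P) (x : ℕ) : P :=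
  if x < n then g x else
    if Even (x - n) then (k ((x - n) / 2)).2 else (k ((x - n) / 2)).1

theorem enumColor_of_lt {P : Type*} {n : ℕ} (g : ℕ → P) (k : ℕ → P × P) {x : ℕ} (hx : x < n) :
    enumColor n g k x = g x :=
  if_pos hx

theorem enumColor_add_two_mul {P : Type*} (n : ℕ) (g : ℕ → P) (k : ℕ → P × P) (j : ℕ) :
    enumColor n g k (n + 2 * j) = (k j).2 := by
  simp [enumColor]

theorem enumColor_add_two_mul_add_one {P : Type*} (n : ℕ) (g : ℕ → P) (k : ℕ → P × P) (j : ℕ) :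
    enumColor n g k (n + 2 * j + 1) = (k j).1 := by
  have hsub : n + 2 * j + 1 - n = 2 * j + 1 := by omega
  have hdiv : (2 * j + 1) / 2 = j := by omega
  have hnot_lt : ¬ n + 2 * j + 1 < n := by omega
  simp [enumColor, hsub, hdiv, hnot_lt]

theorem nonempty_coloredChain (P : Type*) [Preorder P] [Finite P] [Nonempty P] :
    Nonempty (ColoredChain P) := by
  obtain ⟨n, g, hg⟩ := exists_nat_enumeration P
  have : Nonempty {p : P × P // p.1 ≤ p.2} := (‹Nonempty P›).map fun a => ⟨(a, a), le_rfl⟩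
  obtain ⟨m, k, hk⟩ := exists_nat_enumeration {p : P × P // p.1 ≤ p.2}
  exact ⟨{
    N := n + 2 * m
    Fork x := ∃ j < m, x = n + 2 * j + 1
    pos := by omega
    lt := by omega
    isolated := by omega
    n := n
    color := enumColor n g fun j => k j
    n_le := by omega
    lt_of_fork := by omega
    fork_or {x} hn hN := by
      obtain h | h := Nat.mod_two_eq_zero_or_one (x - n)
      · exact .inl ⟨(x - n) / 2, by omega, by omega⟩
      · exact .inr ⟨(x - n) / 2, by omega, by omega⟩
    color_succ_le := by
      rintro x ⟨j, -, h⟩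
      obtain rfl := Nat.succ_injective h
      rw [enumColor_add_two_mul, enumColor_add_two_mul_add_one]
      exact (k j).2
    exists_color p := by
      obtain ⟨i, hi, rfl⟩ := hg p
      exact ⟨i, hi, enumColor_of_lt g _ hi⟩
    exists_fork {p q} hpq := by
      obtain ⟨j, hj, hkj⟩ := hk ⟨(p, q), hpq⟩
      refine ⟨n + 2 * j, ⟨j, hj, rfl⟩, ?_, ?_⟩
      · rw [enumColor_add_two_mul, hkj]
      · rw [enumColor_add_two_mul_add_one, hkj] }⟩

/-! ### Representation of finite distributive lattices -/

instance {K : Type*} [Lattice K] [Subsingleton K] : Unique (LatticeCon K) where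
  default := ⊤
  uniq θ := le_antisymm le_top fun x y _ => Subsingleton.elim x y ▸ θ.iseqv.refl x

instance {P : Type*} [LE P] [IsEmpty P] : Unique (LowerSet P) where
  default := ⊤
  uniq _ := SetLike.ext isEmptyElim

theorem exists_planar_semimodular_of_poset (P : Type*) [Preorder P] [Finite P] :
    ∃ (K : Type) (_ : Lattice K), Finite K ∧ Nonempty K ∧ IsPlanarOrder K ∧
      IsUpperModularLattice K ∧ Nonempty (LowerSet P ≃o LatticeCon K) := by
  obtain hP | hP := isEmpty_or_nonempty P
  · exact ⟨PUnit, inferInstance, inferInstance, inferInstance,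
      isPlanarOrder_of_orderEmbedding_real (.ofMapLEIff (fun _ => 0) (by simp)),
      inferInstance, ⟨OrderIso.ofUnique _ _⟩⟩
  · obtain ⟨C⟩ := nonempty_coloredChain P
    exact ⟨C.Lat, inferInstance, inferInstance, ⟨.base (ForkedChain.Grid.pt _ 0 0)⟩,
      ForkedChain.Cell.isPlanarOrder_eyed _, isUpperModularLattice_of_isWeakUpperModularLattice _,
      ⟨C.conIso.symm⟩⟩

theorem theorem1 {D : Type*} [DistribLattice D] [Finite D] [Nonempty D] :
    ∃ (K : Type) (_ : Lattice K), Finite K ∧ Nonempty K ∧ IsPlanarOrder K ∧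
      IsUpperModularLattice K ∧ Nonempty (D ≃o LatticeCon K) := by
  classical
  have := Fintype.ofFinite D
  let _ : OrderBot D := Fintype.toOrderBot D
  obtain ⟨K, hK, finite, nonempty, planar, semimodular, ⟨e⟩⟩ :=
    exists_planar_semimodular_of_poset {a : D // SupIrred a}
  exact ⟨K, hK, finite, nonempty, planar, semimodular, ⟨OrderIso.lowerSetSupIrred.trans e⟩⟩
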